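/- Let $r > 1$ be an integer. For a commutative ring $R$ let $\mathrm{SL}_2(R)$ be the group of $2\times 2$ matrices over $R$ of determinant $1$, and for a group $G$ let $\mathbb C[G]$ be its group algebra over the complex numbers. Then the group algebras $\mathbb C[\mathrm{SL}_2(\mathbb Z/2^{2r}\mathbb Z)]$ and $\mathbb C[\mathrm{SL}_2(\mathbb F_2[t]/(t^{2r}))]$ are not isomorphic as $\mathbb C$-algebras. -/

import Mathlib

open Matrix commutatorElement

/-! An isomorphism of algebras matches their surjections onto `M₃(ℂ)`, so it suffices to count
irreducible characters of degree three: there are at most 16 over `𝔽₂[t]/(t^{2r})` and at least 28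
over `ℤ/2^{2r}`.

Upper bound: the preimage `I` of the Borel subgroup of `SL₂(𝔽₂)` has index three and is a 2-group.
An irreducible representation of degree three restricted to `I` contains a linear character `χ`,
because `3` is odd and irreducible degrees of a 2-group are powers of two. By Frobenius reciprocity
it is then induced from `χ`. In characteristic two the abelianization of `I` is generated by four
involutions, leaving at most `2⁴` choices (`iwahori_le_of_commutator_mem`).

Lower bound: since `r > 1`, there is a reduction map to `ℤ/16`. There every unit squares to `1` or
`9`, so torus commutators kill much less, and `I` has an explicit family of linear characters with
values of order up to 8 (`iwahoriExponent_mul`). Inducing them gives irreducible representations,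
told apart by their traces at two unipotents. -/

/-! ### Eigenvectors of 2-groups in dimension three -/

/-- A finite `2`-group acting on a three-dimensional complex space stabilises a line. -/
theorem exists_common_eigenvector_of_card_eq_two_pow {V : Type*} [AddCommGroup V] [Module ℂ V]
    (hV : Module.finrank ℂ V = 3) (n : ℕ) :
    ∀ {P : Type*} [Group P] [Finite P] (ρ : Representation ℂ P V), Nat.card P = 2 ^ n →
      ∃ v : V, v ≠ 0 ∧ ∀ p, ∃ c : ℂ, ρ p v = c • v := by
  have hfin : Module.Finite ℂ V := Module.finite_of_finrank_pos (by omega)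
  induction n with
  | zero =>
    intro P _ _ ρ hP
    have : Nontrivial V := Module.nontrivial_of_finrank_pos (R := ℂ) (by omega)
    obtain ⟨v, hv⟩ := exists_ne (0 : V)
    have : Subsingleton P := (Nat.card_eq_one_iff_unique.mp (by simpa using hP)).1
    exact ⟨v, hv, fun p => ⟨1, by simp [Subsingleton.elim p 1]⟩⟩
  | succ n ih =>
    intro P _ _ ρ hP
    obtain ⟨N, hN⟩ := Sylow.exists_subgroup_card_pow_prime (G := P) 2 (n := n)
      (by rw [hP]; exact pow_dvd_pow 2 (Nat.le_succ n))
    have hindex : N.index = 2 := by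
      have h := N.card_mul_index
      rw [hN, hP, pow_succ] at h
      exact Nat.eq_of_mul_eq_mul_left (by positivity) h
    have hnormal : N.Normal := Subgroup.normal_of_index_eq_two hindex
    obtain ⟨v, hv, hNv⟩ := ih (ρ.comp N.subtype) hN
    replace hNv : ∀ p ∈ N, ∃ c : ℂ, ρ p v = c • v := fun p hp => hNv ⟨p, hp⟩
    obtain ⟨g, hg⟩ : ∃ g, g ∉ N := by
      by_contra! h
      rw [(Subgroup.eq_top_iff' N).mpr h] at hindex
      simp at hindex
    have key : ∀ p, p ∈ N ∨ ∃ q ∈ N, p = g * q := fun p => by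
      by_cases hp : p ∈ N
      · exact .inl hp
      · refine .inr ⟨g⁻¹ * p, ?_, by simp⟩
        rw [Subgroup.mul_mem_iff_of_index_two hindex, inv_mem_iff]
        tauto
    by_cases hgv : ∃ c : ℂ, ρ g v = c • v
    · obtain ⟨c, hc⟩ := hgv
      refine ⟨v, hv, fun p => ?_⟩
      obtain hp | ⟨q, hq, rfl⟩ := key p
      · exact hNv p hp
      · obtain ⟨d, hd⟩ := hNv q hq
        exact ⟨d * c, by simp [hd, hc, mul_smul]⟩
    -- The span of `v` and `ρ g v` is stable: normality of `N` makes `ρ g v` another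
    -- `N`-eigenvector, and `g²` lies in `N`. It is a plane here, so its Maschke complement is a
    -- stable line.
    · let W : Subrepresentation ρ :=
        { toSubmodule := Submodule.span ℂ {v, ρ g v}
          apply_mem_toSubmodule := by
            have hNW : ∀ q ∈ N, ∀ x ∈ Submodule.span ℂ {v, ρ g v},
                ρ q x ∈ Submodule.span ℂ {v, ρ g v} := by
              intro q hq x hx
              obtain ⟨a, b, rfl⟩ := Submodule.mem_span_pair.mp hx
              obtain ⟨c, hc⟩ := hNv q hq
              obtain ⟨d, hd⟩ := hNv _ (hnormal.conj_mem' q hq g)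
              have : ρ q (ρ g v) = d • ρ g v := by
                rw [← map_smul, ← hd, ← Module.End.mul_apply, ← Module.End.mul_apply, ← map_mul,
                  ← map_mul]
                congr 2
                group
              refine Submodule.mem_span_pair.mpr ⟨a * c, b * d, ?_⟩
              simp [hc, this, mul_smul]
            intro p x hx
            obtain hp | ⟨q, hq, rfl⟩ := key p
            · exact hNW p hp x hx
            · obtain ⟨a, b, hab⟩ := Submodule.mem_span_pair.mp (hNW q hq x hx)
              obtain ⟨c, hc⟩ := hNv _ (Subgroup.mul_self_mem_of_index_two hindex g)
              rw [map_mul, Module.End.mul_apply] at hc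
              rw [map_mul, Module.End.mul_apply, ← hab]
              refine Submodule.mem_span_pair.mpr ⟨b * c, a, ?_⟩
              simp [hc, mul_smul, add_comm] }
      have hW : Module.finrank ℂ W.toSubmodule = 2 := by
        have hli : LinearIndependent ℂ ![v, ρ g v] := by
          rw [LinearIndependent.pair_iff' hv]
          exact fun a ha => hgv ⟨a, ha.symm⟩
        have := finrank_span_eq_card hli
        rwa [Matrix.range_cons_cons_empty, Fintype.card_fin] at this
      have : NeZero (Nat.card P : ℂ) := ⟨by simp [hP]⟩
      obtain ⟨U, hU⟩ := (inferInstance : Representation.IsSemisimpleRepresentation ρ).exists_isCompl W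
      have hU' : IsCompl W.toSubmodule U.toSubmodule := by
        refine ⟨?_, ?_⟩
        · rw [disjoint_iff, ← Subrepresentation.toSubmodule_inf, hU.inf_eq_bot]; rfl
        · rw [codisjoint_iff, ← Subrepresentation.toSubmodule_sup, hU.sup_eq_top]; rfl
      have h1 : Module.finrank ℂ U.toSubmodule = 1 := by
        have := Submodule.finrank_add_eq_of_isCompl hU'
        omega
      obtain ⟨u, hu, hspan⟩ := finrank_eq_one_iff'.mp h1
      refine ⟨u, by simpa using hu, fun p => ?_⟩
      obtain ⟨c, hc⟩ := hspan ⟨ρ p u, U.apply_mem_toSubmodule p u.2⟩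
      exact ⟨c, (congrArg Subtype.val hc).symm⟩

/-- A three-dimensional complex matrix representation of a finite `2`-group has a common
eigenvector, and the eigenvalues form a linear character. -/
theorem exists_linear_character_of_two_group {P : Type*} [Group P] [Finite P] (hP : IsPGroup 2 P)
    (φ : P →* Matrix (Fin 3) (Fin 3) ℂ) :
    ∃ v : Fin 3 → ℂ, v ≠ 0 ∧ ∃ χ : P →* ℂ, ∀ p, (φ p).mulVec v = χ p • v := by
  obtain ⟨n, hn⟩ := IsPGroup.iff_card.mp hP
  obtain ⟨v, hv, h⟩ := exists_common_eigenvector_of_card_eq_two_pow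
    (V := Fin 3 → ℂ) (by simp) n
    ((Matrix.toLinAlgEquiv' (R := ℂ) (n := Fin 3)).toRingEquiv.toMonoidHom.comp φ) hn
  replace h : ∀ p, ∃ c : ℂ, (φ p).mulVec v = c • v := h
  choose c hc using h
  have hinj := smul_left_injective ℂ hv
  refine ⟨v, hv, { toFun := c, map_one' := hinj ?_, map_mul' := fun p q => hinj ?_ }, hc⟩
  · simp [← hc]
  · change c (p * q) • v = (c p * c q) • v
    rw [← hc, map_mul, ← Matrix.mulVec_mulVec, hc q, Matrix.mulVec_smul, hc p, smul_smul, mul_comm]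

/-! ### Induction from a subgroup of index three -/

open scoped Classical in
/-- The extension by zero of a linear character of a subgroup. -/
noncomputable def extendByZero {G : Type*} [Group G] {P : Subgroup G} (χ : P →* ℂ) (g : G) : ℂ :=
  if h : g ∈ P then χ ⟨g, h⟩ else 0

/-- The matrices of the representation induced from a linear character of a subgroup of index
three with coset representatives `s`. -/
noncomputable def inducedMatrix {G : Type*} [Group G] {P : Subgroup G} (χ : P →* ℂ)
    (s : Fin 3 → G) (g : G) : Matrix (Fin 3) (Fin 3) ℂ :=
  Matrix.of fun j i => extendByZero χ ((s j)⁻¹ * g * s i)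

section Induced

variable {G : Type*} [Group G] {P : Subgroup G} {s : Fin 3 → G}

lemma extendByZero_of_mem (χ : P →* ℂ) {g : G} (h : g ∈ P) : extendByZero χ g = χ ⟨g, h⟩ :=
  dif_pos h

lemma extendByZero_of_notMem (χ : P →* ℂ) {g : G} (h : g ∉ P) : extendByZero χ g = 0 :=
  dif_neg h

lemma extendByZero_mul_of_mem (χ : P →* ℂ) (g : G) {h : G} (hh : h ∈ P) :
    extendByZero χ (g * h) = extendByZero χ g * extendByZero χ h := by
  by_cases hg : g ∈ P
  · rw [extendByZero_of_mem χ hg, extendByZero_of_mem χ hh,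
      extendByZero_of_mem χ (mul_mem hg hh), ← map_mul]
    rfl
  · rw [extendByZero_of_notMem χ hg, extendByZero_of_notMem χ, zero_mul]
    rwa [Subgroup.mul_mem_cancel_right P hh]

/-- A sum over cosets weighted by an extension by zero has one nonzero term. -/
lemma sum_coset_eq (hs : ∀ g, ∃! j, (s j)⁻¹ * g ∈ P) (χ : P →* ℂ) {M : Type*} [AddCommGroup M]
    [Module ℂ M] (g : G) (f : Fin 3 → M) :
    ∃ j, (s j)⁻¹ * g ∈ P ∧
      ∑ i, extendByZero χ ((s i)⁻¹ * g) • f i = extendByZero χ ((s j)⁻¹ * g) • f j := by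
  obtain ⟨j, hj, huniq⟩ := hs g
  refine ⟨j, hj, Finset.sum_eq_single j (fun i _ hi => ?_) (by simp)⟩
  rw [extendByZero_of_notMem χ fun h => hi (huniq i h), zero_smul]

/-- The representation induced from a linear character of a subgroup of index three. -/
noncomputable def inducedHom (hs : ∀ g, ∃! j, (s j)⁻¹ * g ∈ P) (χ : P →* ℂ) :
    G →* Matrix (Fin 3) (Fin 3) ℂ where
  toFun := inducedMatrix χ s
  map_one' := by
    ext j i
    simp only [inducedMatrix, Matrix.of_apply, mul_one]
    by_cases h : j = i
    · subst h
      have : (s j)⁻¹ * s j = 1 := inv_mul_cancel _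
      rw [this, extendByZero_of_mem χ (one_mem P), Matrix.one_apply_eq]
      exact map_one χ
    · rw [Matrix.one_apply_ne h, extendByZero_of_notMem]
      intro hji
      exact h ((hs (s i)).unique hji (by simp [one_mem]))
  map_mul' g h := by
    ext k i
    simp only [inducedMatrix, Matrix.mul_apply, Matrix.of_apply]
    obtain ⟨j, hj, hsum⟩ := sum_coset_eq hs χ (h * s i)
      fun j => extendByZero χ ((s k)⁻¹ * g * s j)
    simp only [smul_eq_mul, ← mul_assoc] at hsum hj
    simp only [mul_comm (extendByZero χ (_ * g * _))]
    rw [hsum, mul_comm, ← extendByZero_mul_of_mem χ _ hj]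
    congr 1
    group

/-- Frobenius reciprocity in trace form: if `φ` generates the full matrix algebra and its
restriction to `P` contains `χ`, then `φ` has the trace of the representation induced from `χ`. -/
theorem trace_eq_trace_inducedMatrix (hs : ∀ g, ∃! j, (s j)⁻¹ * g ∈ P)
    (φ : MonoidAlgebra ℂ G →ₐ[ℂ] Matrix (Fin 3) (Fin 3) ℂ) (hφ : Function.Surjective φ)
    {v : Fin 3 → ℂ} (hv : v ≠ 0) (χ : P →* ℂ)
    (hχ : ∀ p : P, (φ (MonoidAlgebra.of ℂ G p)).mulVec v = χ p • v) (g : G) :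
    (φ (MonoidAlgebra.of ℂ G g)).trace = (inducedMatrix χ s g).trace := by
  -- The columns `φ(sᵢ)v` intertwine the induced representation with `φ`; irreducibility makes `Q`
  -- invertible, so the traces agree.
  let Q : Matrix (Fin 3) (Fin 3) ℂ :=
    Matrix.of fun k i => (φ (MonoidAlgebra.of ℂ G (s i))).mulVec v k
  have hQ : ∀ i, Q.col i = (φ (MonoidAlgebra.of ℂ G (s i))).mulVec v := fun i => rfl
  have hcol : ∀ g i, (φ (MonoidAlgebra.of ℂ G g)).mulVec (Q.col i) =
      ∑ j, extendByZero χ ((s j)⁻¹ * (g * s i)) • Q.col j := by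
    intro g i
    obtain ⟨j, hj, hsum⟩ := sum_coset_eq hs χ (g * s i) Q.col
    have h : MonoidAlgebra.of ℂ G g * MonoidAlgebra.of ℂ G (s i) =
        MonoidAlgebra.of ℂ G (s j) * MonoidAlgebra.of ℂ G ((s j)⁻¹ * (g * s i)) := by
      rw [← map_mul, ← map_mul]
      group
    rw [hsum, extendByZero_of_mem χ hj, hQ, Matrix.mulVec_mulVec, ← map_mul, h, map_mul,
      ← Matrix.mulVec_mulVec, hχ ⟨_, hj⟩, Matrix.mulVec_smul, hQ]
  have hmul : ∀ g, φ (MonoidAlgebra.of ℂ G g) * Q = Q * inducedMatrix χ s g := by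
    intro g
    ext k i
    have := congrFun (hcol g i) k
    simp only [Finset.sum_apply, Pi.smul_apply, smul_eq_mul, Matrix.col_apply] at this
    rw [Matrix.mul_apply, Matrix.mul_apply]
    simpa [Matrix.mulVec, dotProduct, inducedMatrix, mul_assoc, mul_comm] using this
  have hdet : Q.det ≠ 0 := by
    intro hdet
    obtain ⟨w, hw, hwQ⟩ := Matrix.exists_vecMul_eq_zero_iff.mpr hdet
    have hall : ∀ x, Matrix.vecMul w (φ x * Q) = 0 := by
      intro x
      induction x using MonoidAlgebra.induction_on with
      | of g => rw [hmul, ← Matrix.vecMul_vecMul, hwQ, Matrix.zero_vecMul]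
      | add x y hx hy => rw [map_add, add_mul, Matrix.vecMul_add, hx, hy, add_zero]
      | smul c x hx => rw [map_smul, smul_mul_assoc, Matrix.vecMul_smul, hx, smul_zero]
    obtain ⟨i, hi⟩ := Function.ne_iff.mp hw
    obtain ⟨j, -, -⟩ := hs 1
    obtain ⟨k, hk⟩ : ∃ k, Q k j ≠ 0 := by
      by_contra! h
      have h0 : Q.col j = 0 := funext h
      have h1 : (φ (MonoidAlgebra.of ℂ G (s j)⁻¹)).mulVec (Q.col j) = v := by
        rw [hQ, Matrix.mulVec_mulVec, ← map_mul, ← map_mul, inv_mul_cancel, map_one, map_one,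
          Matrix.one_mulVec]
      rw [h0, Matrix.mulVec_zero] at h1
      exact hv h1.symm
    -- For `φ x = Eᵢₖ`, the `j`-th entry of `w (φ x) Q` is `wᵢ Qₖⱼ`, which is nonzero.
    obtain ⟨x, hx⟩ := hφ (Matrix.single i k 1)
    have := congrFun (hall x) j
    rw [hx] at this
    simp only [Matrix.vecMul, dotProduct, Pi.zero_apply] at this
    rw [Finset.sum_eq_single i] at this
    · simp at this
      exact this.elim hi hk
    · intro b _ hb
      simp [hb]
    · simp
  have hunit : IsUnit Q.det := isUnit_iff_ne_zero.mpr hdet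
  have h := hmul g
  have : φ (MonoidAlgebra.of ℂ G g) = Q * inducedMatrix χ s g * Q⁻¹ := by
    rw [← h, mul_assoc, Matrix.mul_nonsing_inv Q hunit, mul_one]
  rw [this, Matrix.trace_mul_cycle, Matrix.nonsing_inv_mul Q hunit, one_mul]

end Induced

/-! ### Unipotents, torus and Iwahori subgroup of `SL₂` -/

section SL2

variable {R : Type*} [CommRing R]

/-- The matrix `(1 b; 0 1)`. -/
def upperUnipotent (b : R) : SpecialLinearGroup (Fin 2) R :=
  ⟨!![1, b; 0, 1], by simp [det_fin_two]⟩

/-- The matrix `(1 0; c 1)`. -/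
def lowerUnipotent (c : R) : SpecialLinearGroup (Fin 2) R :=
  ⟨!![1, 0; c, 1], by simp [det_fin_two]⟩

/-- The matrix `(u 0; 0 u⁻¹)`. -/
def diagonalTorus (u : Rˣ) : SpecialLinearGroup (Fin 2) R :=
  ⟨!![(u : R), 0; 0, (u⁻¹ : Rˣ)], by simp [det_fin_two]⟩

/-- An element of order three in `SL₂(ℤ)`, permuting the three points of the projective line
over `𝔽₂` cyclically. -/
def orderThreeMatrix (R : Type*) [CommRing R] : SpecialLinearGroup (Fin 2) R :=
  ⟨!![0, -1; 1, -1], by simp [det_fin_two]⟩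

@[simp] lemma coe_upperUnipotent (b : R) :
    (upperUnipotent b : Matrix (Fin 2) (Fin 2) R) = !![1, b; 0, 1] := rfl

@[simp] lemma coe_lowerUnipotent (c : R) :
    (lowerUnipotent c : Matrix (Fin 2) (Fin 2) R) = !![1, 0; c, 1] := rfl

@[simp] lemma coe_diagonalTorus (u : Rˣ) :
    (diagonalTorus u : Matrix (Fin 2) (Fin 2) R) = !![(u : R), 0; 0, (u⁻¹ : Rˣ)] := rfl

@[simp] lemma coe_orderThreeMatrix :
    (orderThreeMatrix R : Matrix (Fin 2) (Fin 2) R) = !![0, -1; 1, -1] := rfl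

/-- The upper triangular subgroup of `SL₂(𝔽₂)`. -/
def borelTwo : Subgroup (SpecialLinearGroup (Fin 2) (ZMod 2)) where
  carrier := {M | M 1 0 = 0}
  one_mem' := by decide
  mul_mem' {a b} ha hb := by
    simp only [Set.mem_ofPred_eq] at *
    simp [Matrix.mul_apply, ha, hb]
  inv_mem' {a} ha := by
    simp only [Set.mem_ofPred_eq] at *
    simp [adjugate_fin_two, ha]

/-- The subgroup of `SL₂(R)` of matrices which are upper triangular over the residue field. -/
def iwahori (ε : R →+* ZMod 2) : Subgroup (SpecialLinearGroup (Fin 2) R) :=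
  borelTwo.comap (SpecialLinearGroup.map ε)

lemma mem_iwahori {ε : R →+* ZMod 2} {M : SpecialLinearGroup (Fin 2) R} :
    M ∈ iwahori ε ↔ ε (M 1 0) = 0 := Iff.rfl

/-- Coset representatives of `iwahori ε` in `SL₂(R)`. -/
def cosetRep (R : Type*) [CommRing R] (j : Fin 3) : SpecialLinearGroup (Fin 2) R :=
  orderThreeMatrix R ^ (j : ℕ)

lemma map_cosetRep (ε : R →+* ZMod 2) (j : Fin 3) :
    SpecialLinearGroup.map ε (cosetRep R j) = cosetRep (ZMod 2) j := by
  rw [cosetRep, cosetRep, map_pow]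
  congr 1
  ext i k
  fin_cases i <;> fin_cases k <;> simp

lemma existsUnique_cosetRep_mem_borelTwo (M : SpecialLinearGroup (Fin 2) (ZMod 2)) :
    ∃! j, (cosetRep (ZMod 2) j)⁻¹ * M ∈ borelTwo := by
  -- Quantifying over bare matrices with a determinant hypothesis lets `decide` enumerate the cases.
  have h : ∀ A : Matrix (Fin 2) (Fin 2) (ZMod 2), ∀ hA : A.det = 1, ∃ j,
      ((cosetRep (ZMod 2) j)⁻¹ * ⟨A, hA⟩ : SpecialLinearGroup (Fin 2) (ZMod 2)) 1 0 = 0 ∧ ∀ k,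
      ((cosetRep (ZMod 2) k)⁻¹ * ⟨A, hA⟩ : SpecialLinearGroup (Fin 2) (ZMod 2)) 1 0 = 0 →
        k = j := by
    decide
  exact h M.1 M.2

lemma existsUnique_cosetRep_mem_iwahori (ε : R →+* ZMod 2) (M : SpecialLinearGroup (Fin 2) R) :
    ∃! j, (cosetRep R j)⁻¹ * M ∈ iwahori ε := by
  simpa [iwahori, map_cosetRep] using
    existsUnique_cosetRep_mem_borelTwo (SpecialLinearGroup.map ε M)

lemma upperUnipotent_mem_iwahori (ε : R →+* ZMod 2) (b : R) : upperUnipotent b ∈ iwahori ε := by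
  simp [mem_iwahori]

lemma lowerUnipotent_mem_iwahori {ε : R →+* ZMod 2} {c : R} (hc : ε c = 0) :
    lowerUnipotent c ∈ iwahori ε := by
  simp [mem_iwahori, hc]

lemma diagonalTorus_mem_iwahori (ε : R →+* ZMod 2) (u : Rˣ) : diagonalTorus u ∈ iwahori ε := by
  simp [mem_iwahori]

lemma upperUnipotent_add (a b : R) :
    upperUnipotent (a + b) = upperUnipotent a * upperUnipotent b := by
  ext i j
  fin_cases i <;> fin_cases j <;> simp [add_comm]

lemma lowerUnipotent_add (a b : R) :
    lowerUnipotent (a + b) = lowerUnipotent a * lowerUnipotent b := by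
  ext i j
  fin_cases i <;> fin_cases j <;> simp

lemma upperUnipotent_zero : upperUnipotent (0 : R) = 1 := by
  ext i j
  fin_cases i <;> fin_cases j <;> simp

lemma lowerUnipotent_zero : lowerUnipotent (0 : R) = 1 := by
  ext i j
  fin_cases i <;> fin_cases j <;> simp

lemma commutator_diagonalTorus_upperUnipotent (u : Rˣ) (b : R) :
    ⁅diagonalTorus u, upperUnipotent b⁆ = upperUnipotent (((u : R) ^ 2 - 1) * b) := by
  rw [commutatorElement_def, mul_inv_eq_iff_eq_mul, mul_inv_eq_iff_eq_mul]
  ext i j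
  fin_cases i <;> fin_cases j <;> simp
  linear_combination (-(u : R) * b) * u.mul_inv

/-- Conjugation by the torus scales lower unipotents by the inverse factor, so `u⁻¹` yields the same
`u² - 1` as in the upper case. -/
lemma commutator_diagonalTorus_inv_lowerUnipotent (u : Rˣ) (c : R) :
    ⁅diagonalTorus u⁻¹, lowerUnipotent c⁆ = lowerUnipotent (((u : R) ^ 2 - 1) * c) := by
  rw [commutatorElement_def, mul_inv_eq_iff_eq_mul, mul_inv_eq_iff_eq_mul]
  ext i j
  fin_cases i <;> fin_cases j <;> simp
  linear_combination (-(u : R) * c) * u.mul_inv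

lemma eq_lower_mul_diagonal_mul_upper (M : SpecialLinearGroup (Fin 2) R) (u : Rˣ)
    (hu : M 0 0 = u) :
    M = lowerUnipotent (M 1 0 * (u⁻¹ : Rˣ)) * diagonalTorus u *
      upperUnipotent ((u⁻¹ : Rˣ) * M 0 1) := by
  have hdet := M.det_coe
  rw [det_fin_two, hu] at hdet
  ext i j
  fin_cases i <;> fin_cases j <;>
    simp [hu]
  linear_combination ((u⁻¹ : Rˣ) : R) * hdet - M 1 1 * u.mul_inv

/-- When `y` lies in the maximal ideal, so do both lower entries, and every factor is in the Iwahori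
subgroup. The torus therefore needs no generators of its own. -/
lemma diagonalTorus_eq (u : Rˣ) (y : R) (hu : (u : R) = 1 + y) :
    diagonalTorus u = lowerUnipotent (-(y * (u⁻¹ : Rˣ))) * upperUnipotent 1 * lowerUnipotent y *
      upperUnipotent (-((u⁻¹ : Rˣ) : R)) := by
  have h : ((u⁻¹ : Rˣ) : R) * (1 + y) = 1 := by rw [← hu, u.inv_mul]
  ext i j
  fin_cases i <;> fin_cases j <;>
    simp [hu]
  · linear_combination h
  · linear_combination y * h
  · linear_combination (1 - y * ((u⁻¹ : Rˣ) : R)) * h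

end SL2

/-! ### Iwahori subgroup in characteristic two -/

section CharTwo

variable {R : Type*} [CommRing R] {ε : R →+* ZMod 2} {t : R}

lemma eq_or_eq_one_add_of_ker_le (hker : ∀ x, ε x = 0 → ∃ y, x = t * y) (x : R) :
    ∃ y, x = t * y ∨ x = 1 + t * y := by
  have h01 : ∀ z : ZMod 2, z = 0 ∨ z = 1 := by decide
  obtain h | h := h01 (ε x)
  · obtain ⟨y, hy⟩ := hker x h
    exact ⟨y, .inl hy⟩
  · obtain ⟨y, hy⟩ := hker (x - 1) (by simp [h])
    exact ⟨y, .inr (by rw [← hy]; ring)⟩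

lemma isUnit_one_add_mul_of_isNilpotent (ht : IsNilpotent t) (x : R) : IsUnit (1 + t * x) :=
  IsNilpotent.isUnit_one_add (Commute.isNilpotent_mul_right (Commute.all t x) ht)

/-- In characteristic two, the Iwahori subgroup is generated modulo commutators by four unipotent
elements. -/
theorem iwahori_le_of_commutator_mem [CharP R 2] (hker : ∀ x, ε x = 0 → ∃ y, x = t * y)
    (hεt : ε t = 0) (ht : IsNilpotent t) {E : Subgroup (SpecialLinearGroup (Fin 2) R)}
    (hE : ∀ x ∈ iwahori ε, ∀ y ∈ iwahori ε, ⁅x, y⁆ ∈ E)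
    (h₁ : upperUnipotent 1 ∈ E) (h₂ : upperUnipotent t ∈ E)
    (h₃ : lowerUnipotent t ∈ E) (h₄ : lowerUnipotent (t ^ 2) ∈ E) : iwahori ε ≤ E := by
  -- For `u = 1 + t` one has `u² - 1 = t²`, so commutators supply the upper entries in `t²R` and the
  -- lower ones in `t³R`. What remains is `R/t²` above and `tR/t³` below, generated by `1, t` and by
  -- `t, t²`.
  obtain ⟨u, hu⟩ : IsUnit (1 + t) := IsNilpotent.isUnit_one_add ht
  have hu2 : (u : R) ^ 2 - 1 = t ^ 2 := by
    rw [hu]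
    linear_combination t * CharTwo.two_eq_zero (R := R)
  have hupper2 : ∀ b, upperUnipotent (t ^ 2 * b) ∈ E := fun b => by
    rw [← hu2, ← commutator_diagonalTorus_upperUnipotent]
    exact hE _ (diagonalTorus_mem_iwahori ε _) _ (upperUnipotent_mem_iwahori ε _)
  have hlower2 : ∀ c, lowerUnipotent (t ^ 2 * (t * c)) ∈ E := fun c => by
    rw [← hu2, ← commutator_diagonalTorus_inv_lowerUnipotent]
    exact hE _ (diagonalTorus_mem_iwahori ε _) _ (lowerUnipotent_mem_iwahori (by simp [hεt]))
  have hupper1 : ∀ b, upperUnipotent (t * b) ∈ E := fun b => by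
    obtain ⟨y, rfl | rfl⟩ := eq_or_eq_one_add_of_ker_le hker b
    · convert hupper2 y using 2
      ring
    · rw [show t * (1 + t * y) = t + t ^ 2 * y by ring, upperUnipotent_add]
      exact mul_mem h₂ (hupper2 y)
  have hupper : ∀ b, upperUnipotent b ∈ E := fun b => by
    obtain ⟨y, rfl | rfl⟩ := eq_or_eq_one_add_of_ker_le hker b
    · exact hupper1 y
    · rw [upperUnipotent_add]
      exact mul_mem h₁ (hupper1 y)
  have hlower1 : ∀ c, lowerUnipotent (t * (t * c)) ∈ E := fun c => by
    obtain ⟨y, rfl | rfl⟩ := eq_or_eq_one_add_of_ker_le hker c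
    · convert hlower2 y using 2
      ring
    · rw [show t * (t * (1 + t * y)) = t ^ 2 + t ^ 2 * (t * y) by ring, lowerUnipotent_add]
      exact mul_mem h₄ (hlower2 y)
  have hlower : ∀ c, lowerUnipotent (t * c) ∈ E := fun c => by
    obtain ⟨y, rfl | rfl⟩ := eq_or_eq_one_add_of_ker_le hker c
    · exact hlower1 y
    · rw [show t * (1 + t * y) = t + t * (t * y) by ring, lowerUnipotent_add]
      exact mul_mem h₃ (hlower1 y)
  have htorus : ∀ (v : Rˣ) (y : R), (v : R) = 1 + t * y → diagonalTorus v ∈ E := fun v y hv => by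
    rw [diagonalTorus_eq v _ hv]
    refine mul_mem (mul_mem (mul_mem ?_ (hupper _)) (hlower _)) (hupper _)
    rw [mul_assoc, ← mul_neg]
    exact hlower _
  intro M hM
  obtain ⟨c, hc⟩ := hker _ (mem_iwahori.mp hM)
  have hdet := M.det_coe
  rw [det_fin_two, hc] at hdet
  obtain ⟨y, hy⟩ : ∃ y, M 0 0 = 1 + t * y := by
    obtain ⟨y, hy | hy⟩ := eq_or_eq_one_add_of_ker_le hker (M 0 0)
    · have := congrArg ε hdet
      simp [hy, hεt] at this
    · exact ⟨y, hy⟩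
  obtain ⟨v, hv⟩ := isUnit_one_add_mul_of_isNilpotent ht y
  rw [eq_lower_mul_diagonal_mul_upper M v (hy.trans hv.symm), hc, mul_assoc t]
  exact mul_mem (mul_mem (hlower _) (htorus v y hv)) (hupper _)

/-- The Iwahori subgroup over a local ring of characteristic two with nilpotent maximal ideal is a
`2`-group. -/
theorem isPGroup_iwahori [CharP R 2] (hker : ∀ x, ε x = 0 → ∃ y, x = t * y)
    (ht : IsNilpotent t) : IsPGroup 2 (iwahori ε) := by
  obtain ⟨n, hn⟩ := ht
  have hn' : t ^ 2 ^ n = 0 := pow_eq_zero_of_le (Nat.lt_two_pow_self).le hn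
  rintro ⟨p, hp⟩
  refine ⟨n + 1, Subtype.ext ?_⟩
  rw [pow_succ', pow_mul]
  change (p ^ 2) ^ 2 ^ n = 1
  -- The Borel subgroup of `SL₂(𝔽₂)` has exponent two, so `p² = 1 + tY`; Frobenius then gives `(1 +
  -- tY)^(2ⁿ) = 1 + t^(2ⁿ) Y^(2ⁿ) = 1`.
  have hsq : (p.1 * p.1).map ε = 1 := by
    have h : ∀ A : Matrix (Fin 2) (Fin 2) (ZMod 2), A.det = 1 → A 1 0 = 0 → A * A = 1 := by
      decide
    rw [Matrix.map_mul]
    exact h _ (SpecialLinearGroup.map ε p).2 hp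
  have hentry : ∀ i j, ∃ y, (p.1 * p.1) i j - (1 : Matrix (Fin 2) (Fin 2) R) i j = t * y := by
    intro i j
    refine hker _ ?_
    have := congrFun (congrFun hsq i) j
    rw [map_apply] at this
    rw [map_sub, this, one_apply, one_apply]
    split <;> simp
  choose Y hY using hentry
  have hp2 : p.1 * p.1 = 1 + t • Matrix.of Y := by
    ext i j
    simp [← hY]
  have hcoe : (((p ^ 2) ^ 2 ^ n : SpecialLinearGroup (Fin 2) R) : Matrix (Fin 2) (Fin 2) R) =
      (p.1 * p.1) ^ 2 ^ n := by
    rw [← pow_mul, ← pow_two, ← pow_mul]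
    rfl
  refine Subtype.ext (hcoe.trans ?_)
  rw [hp2, add_pow_char_pow_of_commute 2 _ (Commute.one_left _), smul_pow, hn']
  simp

end CharTwo

/-! ### Upper bound for characters of degree three -/

/-- The traces of the surjective homomorphisms from a complex algebra to `M₃(ℂ)`, that is, the
characters of its simple modules of dimension three. -/
def threeDimCharacters (A : Type*) [Ring A] [Algebra ℂ A] : Set (A →ₗ[ℂ] ℂ) :=
  {τ | ∃ φ : A →ₐ[ℂ] Matrix (Fin 3) (Fin 3) ℂ, Function.Surjective φ ∧
    τ = (traceLinearMap (Fin 3) ℂ ℂ).comp φ.toLinearMap}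

/-- In characteristic two there are at most sixteen characters of degree three. -/
theorem exists_injective_threeDimCharacters {R : Type*} [CommRing R] [CharP R 2] [Finite R]
    {ε : R →+* ZMod 2} {t : R} (hker : ∀ x, ε x = 0 → ∃ y, x = t * y)
    (hεt : ε t = 0) (ht : IsNilpotent t) :
    ∃ f : threeDimCharacters (MonoidAlgebra ℂ (SpecialLinearGroup (Fin 2) R)) → Fin 4 → Bool,
      Function.Injective f := by
  classical
  have hs := existsUnique_cosetRep_mem_iwahori ε
  have hexists : ∀ τ : threeDimCharacters (MonoidAlgebra ℂ (SpecialLinearGroup (Fin 2) R)),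
      ∃ χ : iwahori ε →* ℂ, ∀ g, τ.1 (MonoidAlgebra.of ℂ _ g) =
        (inducedMatrix χ (cosetRep R) g).trace := by
    rintro ⟨τ, φ, hφ, rfl⟩
    obtain ⟨v, hv, χ, hχ⟩ := exists_linear_character_of_two_group (isPGroup_iwahori hker ht)
      ((φ.toRingHom.toMonoidHom.comp (MonoidAlgebra.of ℂ _)).comp (iwahori ε).subtype)
    exact ⟨χ, trace_eq_trace_inducedMatrix hs φ hφ hv χ hχ⟩
  choose χ hχ using hexists
  let gen : Fin 4 → iwahori ε :=
    ![⟨_, upperUnipotent_mem_iwahori ε 1⟩, ⟨_, upperUnipotent_mem_iwahori ε t⟩,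
      ⟨_, lowerUnipotent_mem_iwahori hεt⟩,
      ⟨_, lowerUnipotent_mem_iwahori (c := t ^ 2) (by simp [hεt])⟩]
  have hgen : ∀ i, gen i * gen i = 1 := by
    intro i
    fin_cases i <;> refine Subtype.ext ?_ <;>
      simp [gen, ← upperUnipotent_add, ← lowerUnipotent_add, CharTwo.add_self_eq_zero,
        upperUnipotent_zero, lowerUnipotent_zero]
  have hsign : ∀ τ i, χ τ (gen i) = 1 ∨ χ τ (gen i) = -1 := fun τ i => by
    rw [← mul_self_eq_one_iff, ← map_mul, hgen, map_one]
  refine ⟨fun τ i => decide (χ τ (gen i) = 1), fun τ σ h => ?_⟩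
  have hag : ∀ i, χ τ (gen i) = χ σ (gen i) := fun i => by
    have hi := congrFun h i
    simp only [decide_eq_decide] at hi
    obtain h1 | h1 := hsign τ i
    · rw [h1, hi.mp h1]
    · obtain h2 | h2 := hsign σ i
      · rw [h2, hi.mpr h2]
      · rw [h1, h2]
  have hle : iwahori ε ≤ (MonoidHom.eqLocus (χ τ) (χ σ)).map (iwahori ε).subtype := by
    refine iwahori_le_of_commutator_mem hker hεt ht (fun x hx y hy => ?_)
      ⟨gen 0, hag 0, rfl⟩ ⟨gen 1, hag 1, rfl⟩ ⟨gen 2, hag 2, rfl⟩ ⟨gen 3, hag 3, rfl⟩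
    let c : iwahori ε := ⁅(⟨x, hx⟩ : iwahori ε), (⟨y, hy⟩ : iwahori ε)⁆
    have hcomm : ∀ ψ : iwahori ε →* ℂ, ψ c = 1 := fun ψ => by
      simp only [c, commutatorElement_def]
      rw [map_mul, map_mul, map_mul, mul_assoc, mul_mul_mul_comm, ← map_mul, ← map_mul]
      simp
    exact ⟨c, (hcomm _).trans (hcomm _).symm, rfl⟩
  have heq : χ τ = χ σ := by
    ext p
    obtain ⟨q, hq, hqp⟩ := hle p.2
    rw [← Subtype.ext hqp]
    exact hq
  refine Subtype.ext (MonoidAlgebra.lhom_ext' fun g => LinearMap.ext_ring ?_)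
  exact (hχ τ g).trans ((heq ▸ rfl : _ = _).trans (hχ σ g).symm)

/-! ### Linear characters of the Iwahori subgroup over `ℤ/16` -/

/-- Reduction modulo two on `ℤ/16`. -/
abbrev parity : ZMod 16 →+* ZMod 2 := ZMod.castHom (by norm_num) (ZMod 2)

/-- A family of homomorphisms from the Iwahori subgroup of `SL₂(ℤ/16)` to `ℤ/16`. -/
def iwahoriExponent (x k : ZMod 16) (M : SpecialLinearGroup (Fin 2) (ZMod 16)) : ZMod 16 :=
  x * (M 0 0 * (2 * M 0 1 + M 1 0 + M 0 0 ^ 2 - 1)) + k * (2 * M 0 0 * M 1 0 + 4 * (M 0 0 - 1))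

lemma two_mul_sq_of_parity : ∀ a : ZMod 16, parity a = 1 → 2 * a ^ 2 = 2 := by decide

lemma pow_four_of_parity : ∀ a : ZMod 16, parity a = 1 → a ^ 4 = 1 := by decide

lemma exists_eq_two_mul_of_parity : ∀ c : ZMod 16, parity c = 0 → ∃ f, c = 2 * f := by decide

lemma parity_unit (u : (ZMod 16)ˣ) : parity u = 1 := by
  have h := congrArg parity u.mul_inv
  rw [map_mul, map_one] at h
  exact (by decide : ∀ a b : ZMod 2, a * b = 1 → a = 1) _ _ h

lemma parity_apply_zero_zero {M : SpecialLinearGroup (Fin 2) (ZMod 16)}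
    (hM : M ∈ iwahori parity) : parity (M 0 0) = 1 := by
  have hdet := congrArg parity M.det_coe
  rw [det_fin_two, map_sub, map_mul, map_mul, mem_iwahori.mp hM, map_one] at hdet
  exact (by decide : ∀ a b c : ZMod 2, a * b - c * 0 = 1 → a = 1) _ _ _ hdet

lemma iwahoriExponent_mul_upper (x k b : ZMod 16) {M : SpecialLinearGroup (Fin 2) (ZMod 16)}
    (hM : M ∈ iwahori parity) : iwahoriExponent x k (M * upperUnipotent b) =
      iwahoriExponent x k M + iwahoriExponent x k (upperUnipotent b) := by
  have h := two_mul_sq_of_parity _ (parity_apply_zero_zero hM)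
  simp [iwahoriExponent, Matrix.mul_apply]
  linear_combination x * b * h

/-- On units of `ℤ/16` both `a ↦ a(a² - 1)` and `a ↦ 4(a - 1)` are additive characters: `a² - 1` is
`0` or `8`, and `4(a - 1)(u - 1)` is divisible by 16. -/
lemma iwahoriExponent_mul_diagonal (x k : ZMod 16) (u : (ZMod 16)ˣ)
    {M : SpecialLinearGroup (Fin 2) (ZMod 16)} (hM : M ∈ iwahori parity) :
    iwahoriExponent x k (M * diagonalTorus u) =
      iwahoriExponent x k M + iwahoriExponent x k (diagonalTorus u) := by
  obtain ⟨f, hf⟩ := exists_eq_two_mul_of_parity _ (mem_iwahori.mp hM)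
  have hu := two_mul_sq_of_parity _ (parity_unit u)
  have h₁ : ∀ a u : ZMod 16, parity a = 1 → parity u = 1 →
      a * u * (a ^ 2 * u ^ 2 - 1) = a * (a ^ 2 - 1) + u * (u ^ 2 - 1) := by decide
  have h₂ : ∀ a u : ZMod 16, parity a = 1 → parity u = 1 → 4 * (a - 1) * (u - 1) = 0 := by decide
  replace h₁ := h₁ _ _ (parity_apply_zero_zero hM) (parity_unit u)
  replace h₂ := h₂ _ _ (parity_apply_zero_zero hM) (parity_unit u)
  simp [iwahoriExponent, Matrix.mul_apply, hf]
  linear_combination x * (2 * M 0 0 * M 0 1 * u.mul_inv + M 0 0 * f * hu + h₁) +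
    k * (2 * M 0 0 * f * hu + h₂)

lemma iwahoriExponent_mul_lower_two (x k : ZMod 16) {M : SpecialLinearGroup (Fin 2) (ZMod 16)}
    (hM : M ∈ iwahori parity) : iwahoriExponent x k (M * lowerUnipotent 2) =
      iwahoriExponent x k M + iwahoriExponent x k (lowerUnipotent 2) := by
  have ha := parity_apply_zero_zero hM
  have hdet := M.det_coe
  rw [det_fin_two] at hdet
  -- Since `a⁻¹ = a³`, the determinant eliminates the fourth entry, leaving identities in three
  -- variables over `ℤ/16` for a finite check.
  have hd : M 1 1 = M 0 0 ^ 3 * (1 + M 0 1 * M 1 0) := by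
    linear_combination M 0 0 ^ 3 * hdet - M 1 1 * pow_four_of_parity _ ha
  have h₁ : ∀ a b c : ZMod 16, parity a = 1 → parity c = 0 →
      (a + b * 2) * (2 * b + (c + a ^ 3 * (1 + b * c) * 2) + (a + b * 2) ^ 2 - 1) =
        a * (2 * b + c + a ^ 2 - 1) + 2 := by decide +kernel
  have h₂ : ∀ a b c : ZMod 16, parity a = 1 → parity c = 0 →
      2 * (a + b * 2) * (c + a ^ 3 * (1 + b * c) * 2) + 4 * (a + b * 2 - 1) =
        2 * a * c + 4 * (a - 1) + 4 := by decide +kernel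
  replace h₁ := h₁ _ (M 0 1) _ ha (mem_iwahori.mp hM)
  replace h₂ := h₂ _ (M 0 1) _ ha (mem_iwahori.mp hM)
  simp [iwahoriExponent, Matrix.mul_apply, hd]
  linear_combination x * h₁ + k * h₂

/-- `iwahoriExponent x k` is additive on the Iwahori subgroup. -/
theorem iwahoriExponent_mul (x k : ZMod 16) {M N : SpecialLinearGroup (Fin 2) (ZMod 16)}
    (hM : M ∈ iwahori parity) (hN : N ∈ iwahori parity) :
    iwahoriExponent x k (M * N) = iwahoriExponent x k M + iwahoriExponent x k N := by
  -- Additivity under right multiplication passes to products, so the factors of `N = lower · torus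
  -- · upper` can be treated separately; the lower factor is a power of `lowerUnipotent 2`.
  have hmul : ∀ A ∈ iwahori parity, ∀ B,
      (∀ M ∈ iwahori parity, iwahoriExponent x k (M * A) =
        iwahoriExponent x k M + iwahoriExponent x k A) →
      (∀ M ∈ iwahori parity, iwahoriExponent x k (M * B) =
        iwahoriExponent x k M + iwahoriExponent x k B) →
      ∀ M ∈ iwahori parity, iwahoriExponent x k (M * (A * B)) =
        iwahoriExponent x k M + iwahoriExponent x k (A * B) := by
    intro A hA B h₁ h₂ M hM
    rw [← mul_assoc, h₂ _ (mul_mem hM hA), h₁ _ hM, h₂ _ hA, add_assoc]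
  have hlower : ∀ n : ℕ, ∀ M ∈ iwahori parity,
      iwahoriExponent x k (M * lowerUnipotent (2 * (n : ZMod 16))) =
        iwahoriExponent x k M + iwahoriExponent x k (lowerUnipotent (2 * (n : ZMod 16))) := by
    intro n
    induction n with
    | zero =>
      intro M _
      simp [lowerUnipotent_zero, iwahoriExponent]
    | succ n ih =>
      rw [Nat.cast_succ, mul_add, mul_one, lowerUnipotent_add]
      refine hmul _ (lowerUnipotent_mem_iwahori ?_) _ ih
        fun M hM => iwahoriExponent_mul_lower_two x k hM
      rw [map_mul, (by decide : parity 2 = 0), zero_mul]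
  obtain ⟨u, hu⟩ : IsUnit (N 0 0) :=
    IsUnit.of_mul_eq_one (N 0 0 ^ 3) (by
      rw [← pow_succ', pow_four_of_parity _ (parity_apply_zero_zero hN)])
  have hc : parity (N 1 0 * (u⁻¹ : (ZMod 16)ˣ)) = 0 := by
    rw [map_mul, mem_iwahori.mp hN, zero_mul]
  obtain ⟨f, hf⟩ := exists_eq_two_mul_of_parity _ hc
  rw [eq_lower_mul_diagonal_mul_upper N u hu.symm]
  refine hmul _ (mul_mem (lowerUnipotent_mem_iwahori hc) (diagonalTorus_mem_iwahori _ _)) _ ?_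
    (fun M hM => iwahoriExponent_mul_upper x k _ hM) M hM
  refine hmul _ (lowerUnipotent_mem_iwahori hc) _ ?_
    fun M hM => iwahoriExponent_mul_diagonal x k u hM
  have := hlower f.val
  rwa [ZMod.natCast_zmod_val, ← hf] at this

/-- Linear characters of the Iwahori subgroup of `SL₂(ℤ/16)`. -/
noncomputable def iwahoriCharacter (x k : ZMod 16) : iwahori parity →* ℂ where
  toFun M := ZMod.stdAddChar (iwahoriExponent x k M)
  map_one' := by simp [iwahoriExponent]
  map_mul' M N := by
    rw [Subgroup.coe_mul, iwahoriExponent_mul x k M.2 N.2, AddChar.map_add_eq_mul]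

/-! ### Induced matrices and irreducibility -/

lemma inducedMatrix_apply_of_mem (x k : ZMod 16) (M : SpecialLinearGroup (Fin 2) (ZMod 16))
    (j i : Fin 3)
    (h : parity (((cosetRep (ZMod 16) j)⁻¹ * M * cosetRep (ZMod 16) i) 1 0) = 0) :
    inducedMatrix (iwahoriCharacter x k) (cosetRep _) M j i =
      ZMod.stdAddChar (iwahoriExponent x k
        ((cosetRep (ZMod 16) j)⁻¹ * M * cosetRep (ZMod 16) i)) :=
  extendByZero_of_mem _ (mem_iwahori.mpr h)

lemma inducedMatrix_apply_of_notMem (x k : ZMod 16) (M : SpecialLinearGroup (Fin 2) (ZMod 16))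
    (j i : Fin 3)
    (h : parity (((cosetRep (ZMod 16) j)⁻¹ * M * cosetRep (ZMod 16) i) 1 0) ≠ 0) :
    inducedMatrix (iwahoriCharacter x k) (cosetRep _) M j i = 0 :=
  extendByZero_of_notMem _ fun hM => h (mem_iwahori.mp hM)

/-- Subtracting `β` and rescaling turns the diagonal matrix into `E₀₀`; multiplying by powers of the
cycle on both sides gives every matrix unit. -/
lemma subalgebra_eq_top_of_diagonal_mem_of_cycle_mem {S : Subalgebra ℂ (Matrix (Fin 3) (Fin 3) ℂ)}
    {α β : ℂ} (hαβ : α ≠ β) (hD : !![α, 0, 0; 0, β, 0; 0, 0, β] ∈ S)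
    (hC : !![0, 0, 1; 1, 0, 0; 0, 1, 0] ∈ S) : S = ⊤ := by
  have hE : !![1, 0, 0; 0, 0, 0; 0, 0, 0] ∈ S := by
    have h : !![1, 0, 0; 0, 0, 0; 0, 0, 0] =
        (α - β)⁻¹ • (!![α, 0, 0; 0, β, 0; 0, 0, β] - β • (1 : Matrix (Fin 3) (Fin 3) ℂ)) := by
      ext i j
      fin_cases i <;> fin_cases j <;> simp [sub_ne_zero.mpr hαβ]
    rw [h]
    exact S.smul_mem (S.sub_mem hD (S.smul_mem S.one_mem _)) _
  have hEij : ∀ i j : Fin 3, single i j (1 : ℂ) ∈ S := by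
    intro i j
    have h : single i j (1 : ℂ) = !![0, 0, 1; 1, 0, 0; 0, 1, 0] ^ (i : ℕ) *
        !![1, 0, 0; 0, 0, 0; 0, 0, 0] * !![0, 0, 1; 1, 0, 0; 0, 1, 0] ^ (3 - (j : ℕ)) := by
      fin_cases i <;> fin_cases j <;> ext k l <;> fin_cases k <;> fin_cases l <;>
        simp [pow_succ]
    rw [h]
    exact S.mul_mem (S.mul_mem (S.pow_mem hC _) hE) (S.pow_mem hC _)
  refine Algebra.eq_top_iff.mpr fun M => ?_
  rw [matrix_eq_sum_single M]
  refine S.sum_mem fun i _ => S.sum_mem fun j _ => ?_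
  have : single i j (M i j) = M i j • single i j (1 : ℂ) := by simp
  rw [this]
  exact S.smul_mem (hEij i j) _

/-- The element is trivial modulo two, hence lies in every conjugate of the Iwahori subgroup and
acts diagonally. -/
lemma inducedMatrix_upperUnipotent_two (x k : ZMod 16) :
    inducedMatrix (iwahoriCharacter x k) (cosetRep _) (upperUnipotent 2) =
      !![ZMod.stdAddChar (4 * x), 0, 0; 0, ZMod.stdAddChar (-2 * x - 4 * k), 0;
        0, 0, ZMod.stdAddChar (-2 * x - 4 * k)] := by
  ext j i
  fin_cases j <;> fin_cases i
  · refine (inducedMatrix_apply_of_mem x k _ 0 0 (by decide +kernel)).trans (congrArg _ ?_)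
    revert x k
    decide +kernel
  · exact inducedMatrix_apply_of_notMem x k _ 0 1 (by decide +kernel)
  · exact inducedMatrix_apply_of_notMem x k _ 0 2 (by decide +kernel)
  · exact inducedMatrix_apply_of_notMem x k _ 1 0 (by decide +kernel)
  · refine (inducedMatrix_apply_of_mem x k _ 1 1 (by decide +kernel)).trans (congrArg _ ?_)
    revert x k
    decide +kernel
  · exact inducedMatrix_apply_of_notMem x k _ 1 2 (by decide +kernel)
  · exact inducedMatrix_apply_of_notMem x k _ 2 0 (by decide +kernel)
  · exact inducedMatrix_apply_of_notMem x k _ 2 1 (by decide +kernel)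
  · refine (inducedMatrix_apply_of_mem x k _ 2 2 (by decide +kernel)).trans (congrArg _ ?_)
    revert x k
    decide +kernel

/-- Modulo two this element fixes just one point of the projective line, so only one diagonal entry
survives. -/
lemma trace_inducedMatrix_upperUnipotent_one (x k : ZMod 16) :
    (inducedMatrix (iwahoriCharacter x k) (cosetRep _) (upperUnipotent 1)).trace =
      ZMod.stdAddChar (2 * x) := by
  rw [trace_fin_three, inducedMatrix_apply_of_notMem x k _ 1 1 (by decide +kernel),
    inducedMatrix_apply_of_notMem x k _ 2 2 (by decide +kernel), add_zero, add_zero,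
    inducedMatrix_apply_of_mem x k _ 0 0 (by decide +kernel)]
  refine congrArg _ ?_
  revert x k
  decide +kernel

lemma inducedMatrix_orderThreeMatrix (x k : ZMod 16) :
    inducedMatrix (iwahoriCharacter x k) (cosetRep _) (orderThreeMatrix _) =
      !![0, 0, 1; 1, 0, 0; 0, 1, 0] := by
  have h : ∀ j i : Fin 3, j = i + 1 →
      inducedMatrix (iwahoriCharacter x k) (cosetRep _) (orderThreeMatrix _) j i = 1 := by
    intro j i hji
    have h1 : (cosetRep (ZMod 16) j)⁻¹ * orderThreeMatrix _ * cosetRep (ZMod 16) i = 1 := by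
      revert j i
      decide +kernel
    rw [inducedMatrix_apply_of_mem x k _ _ _ (by rw [h1]; decide), h1]
    exact map_one (iwahoriCharacter x k)
  have h' : ∀ j i : Fin 3, j ≠ i + 1 →
      inducedMatrix (iwahoriCharacter x k) (cosetRep _) (orderThreeMatrix _) j i = 0 := by
    intro j i hji
    refine inducedMatrix_apply_of_notMem x k _ _ _ ?_
    revert j i
    decide +kernel
  ext j i
  fin_cases j <;> fin_cases i
  exacts [h' _ _ (by decide), h' _ _ (by decide), h _ _ (by decide), h _ _ (by decide),
    h' _ _ (by decide), h' _ _ (by decide), h' _ _ (by decide), h _ _ (by decide),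
    h' _ _ (by decide)]

/-! ### Lower bound by inflation from `ℤ/16` -/

section LowerBound

variable {R : Type*} [CommRing R]

/-- The three-dimensional representations of `ℂ[SL₂(R)]` obtained from those of `SL₂(ℤ/16)` by
reduction. -/
noncomputable def inflatedRepresentation (π : R →+* ZMod 16) (x k : ZMod 16) :
    MonoidAlgebra ℂ (SpecialLinearGroup (Fin 2) R) →ₐ[ℂ] Matrix (Fin 3) (Fin 3) ℂ :=
  MonoidAlgebra.lift ℂ _ _ ((inducedHom (existsUnique_cosetRep_mem_iwahori parity)
    (iwahoriCharacter x k)).comp (SpecialLinearGroup.map π))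

lemma inflatedRepresentation_of (π : R →+* ZMod 16) (x k : ZMod 16)
    (g : SpecialLinearGroup (Fin 2) R) :
    inflatedRepresentation π x k (MonoidAlgebra.of ℂ _ g) =
      inducedMatrix (iwahoriCharacter x k) (cosetRep _) (SpecialLinearGroup.map π g) :=
  MonoidAlgebra.lift_of _ _

lemma map_upperUnipotent {S : Type*} [CommRing S] (π : R →+* S) (b : R) :
    SpecialLinearGroup.map π (upperUnipotent b) = upperUnipotent (π b) := by
  ext i j
  fin_cases i <;> fin_cases j <;> simp

lemma map_orderThreeMatrix {S : Type*} [CommRing S] (π : R →+* S) :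
    SpecialLinearGroup.map π (orderThreeMatrix R) = orderThreeMatrix S := by
  ext i j
  fin_cases i <;> fin_cases j <;> simp

lemma inflatedRepresentation_surjective (π : R →+* ZMod 16) {x k : ZMod 16}
    (h : 6 * x + 4 * k ≠ 0) : Function.Surjective (inflatedRepresentation π x k) := by
  have hne : ZMod.stdAddChar (4 * x) ≠ ZMod.stdAddChar (-2 * x - 4 * k) := fun he => h <| by
    linear_combination ZMod.injective_stdAddChar he
  rw [← AlgHom.range_eq_top]
  refine subalgebra_eq_top_of_diagonal_mem_of_cycle_mem hne
    ⟨MonoidAlgebra.of ℂ _ (upperUnipotent 2), ?_⟩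
    ⟨MonoidAlgebra.of ℂ _ (orderThreeMatrix R), ?_⟩
  · refine (inflatedRepresentation_of π x k _).trans ?_
    rw [map_upperUnipotent, map_ofNat, inducedMatrix_upperUnipotent_two]
  · refine (inflatedRepresentation_of π x k _).trans ?_
    rw [map_orderThreeMatrix, inducedMatrix_orderThreeMatrix]

lemma eq_of_trace_inflatedRepresentation_eq (π : R →+* ZMod 16) {x k x' k' : ZMod 16}
    (h : ∀ a, (inflatedRepresentation π x k a).trace = (inflatedRepresentation π x' k' a).trace) :
    2 * x = 2 * x' ∧ 2 * x + 4 * k = 2 * x' + 4 * k' := by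
  have h1 := h (MonoidAlgebra.of ℂ _ (upperUnipotent 1))
  have h2 := h (MonoidAlgebra.of ℂ _ (upperUnipotent 2))
  rw [inflatedRepresentation_of, inflatedRepresentation_of, map_upperUnipotent, map_one,
    trace_inducedMatrix_upperUnipotent_one, trace_inducedMatrix_upperUnipotent_one] at h1
  replace h1 := ZMod.injective_stdAddChar h1
  rw [inflatedRepresentation_of, inflatedRepresentation_of, map_upperUnipotent, map_ofNat,
    inducedMatrix_upperUnipotent_two, inducedMatrix_upperUnipotent_two,
    show 4 * x = 4 * x' by linear_combination 2 * h1] at h2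
  simp only [trace_fin_three, of_apply, cons_val', cons_val_zero, cons_val_one, cons_val,
    add_assoc, add_right_inj, ← two_mul] at h2
  replace h2 := ZMod.injective_stdAddChar (mul_left_cancel₀ two_ne_zero h2)
  exact ⟨h1, by linear_combination -h2⟩

/-- Over a ring with residue ring `ℤ/16` there are at least twenty-eight characters of degree
three. -/
theorem exists_injective_to_threeDimCharacters (π : R →+* ZMod 16) :
    ∃ f : {p : Fin 8 × Fin 4 // 6 * ((p.1 : ℕ) : ZMod 16) + 4 * ((p.2 : ℕ) : ZMod 16) ≠ 0} →
      threeDimCharacters (MonoidAlgebra ℂ (SpecialLinearGroup (Fin 2) R)),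
      Function.Injective f := by
  -- The traces recover `2x` and `2x + 4k` modulo 16, hence `x` modulo 8 and `k` modulo 4.
  refine ⟨fun p => ⟨_, inflatedRepresentation π (p.1.1 : ℕ) (p.1.2 : ℕ),
    inflatedRepresentation_surjective π p.2, rfl⟩, fun p q hpq => ?_⟩
  obtain ⟨h1, h2⟩ := eq_of_trace_inflatedRepresentation_eq π
    fun a => congrArg (fun τ => τ.1 a) hpq
  have hdec : ∀ p q : Fin 8 × Fin 4,
      2 * ((p.1 : ℕ) : ZMod 16) = 2 * ((q.1 : ℕ) : ZMod 16) →
      2 * ((p.1 : ℕ) : ZMod 16) + 4 * ((p.2 : ℕ) : ZMod 16) =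
        2 * ((q.1 : ℕ) : ZMod 16) + 4 * ((q.2 : ℕ) : ZMod 16) → p = q := by
    decide +kernel
  exact Subtype.ext (hdec _ _ h1 h2)

end LowerBound

/-! ### The ring `𝔽₂[t]/(tⁿ)` -/

section TruncatedPolynomial

open Polynomial

variable (n : ℕ)

/-- The truncated polynomial ring `𝔽₂[t]/(tⁿ)`. -/
abbrev TruncatedPolynomial : Type := (ZMod 2)[X] ⧸ Ideal.span ({X ^ n} : Set (ZMod 2)[X])

variable {n}

/-- Evaluation at zero on `𝔽₂[t]/(tⁿ)`. -/
noncomputable def truncatedEval (hn : n ≠ 0) : TruncatedPolynomial n →+* ZMod 2 :=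
  Ideal.Quotient.lift _ constantCoeff fun p hp => by
    obtain ⟨q, rfl⟩ := Ideal.mem_span_singleton.mp hp
    simp [hn.symm]

lemma exists_eq_mul_of_truncatedEval_eq_zero (hn : n ≠ 0) (x : TruncatedPolynomial n)
    (hx : truncatedEval hn x = 0) : ∃ y, x = Ideal.Quotient.mk _ X * y := by
  obtain ⟨p, rfl⟩ := Ideal.Quotient.mk_surjective x
  obtain ⟨q, rfl⟩ : X ∣ p := X_dvd_iff.mpr hx
  exact ⟨Ideal.Quotient.mk _ q, map_mul _ _ _⟩

instance : Finite (TruncatedPolynomial n) :=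
  have := (monic_X_pow (R := ZMod 2) n).finite_quotient
  Module.finite_of_finite (ZMod 2)

lemma charP_truncatedPolynomial (hn : n ≠ 0) : CharP (TruncatedPolynomial n) 2 :=
  have : Nontrivial (TruncatedPolynomial n) := (truncatedEval hn).domain_nontrivial
  charP_of_injective_algebraMap (algebraMap (ZMod 2) (TruncatedPolynomial n)).injective 2

/-- There are at most sixteen characters of degree three of `SL₂(𝔽₂[t]/(tⁿ))`. -/
theorem exists_injective_threeDimCharacters_truncatedPolynomial (hn : n ≠ 0) :
    ∃ f : threeDimCharacters (MonoidAlgebra ℂ (SpecialLinearGroup (Fin 2)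
      (TruncatedPolynomial n))) → Fin 4 → Bool, Function.Injective f := by
  have := charP_truncatedPolynomial hn
  refine exists_injective_threeDimCharacters (exists_eq_mul_of_truncatedEval_eq_zero hn)
    (t := Ideal.Quotient.mk _ X) ?_ ⟨n, ?_⟩
  · simp [truncatedEval]
  · rw [← map_pow, Ideal.Quotient.eq_zero_iff_mem]
    exact Ideal.mem_span_singleton_self _

end TruncatedPolynomial

/-! ### Comparison of the two counts -/

lemma exists_injective_threeDimCharacters_of_algEquiv {A B : Type*} [Ring A] [Algebra ℂ A]
    [Ring B] [Algebra ℂ B] (e : A ≃ₐ[ℂ] B) :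
    ∃ f : threeDimCharacters A → threeDimCharacters B, Function.Injective f := by
  refine ⟨fun τ => ⟨τ.1.comp e.symm.toLinearMap, ?_⟩, fun τ σ h => ?_⟩
  · obtain ⟨φ, hφ, hτ⟩ := τ.2
    exact ⟨φ.comp e.symm.toAlgHom, hφ.comp e.symm.surjective, by rw [hτ]; rfl⟩
  · refine Subtype.ext (LinearMap.ext fun a => ?_)
    have := LinearMap.congr_fun (congrArg Subtype.val h) (e a)
    simpa using this

theorem mainTheorem3 (r : ℕ) (hr : 1 < r) :
    IsEmpty
      (MonoidAlgebra ℂ (Matrix.SpecialLinearGroup (Fin 2) (ZMod (2 ^ (2 * r)))) ≃ₐ[ℂ]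
        MonoidAlgebra ℂ (Matrix.SpecialLinearGroup (Fin 2)
          (Polynomial (ZMod 2) ⧸
            Ideal.span ({Polynomial.X ^ (2 * r)} : Set (Polynomial (ZMod 2)))))) := by
  refine ⟨fun e => ?_⟩
  have h16 : 16 ∣ 2 ^ (2 * r) := pow_dvd_pow 2 (show 4 ≤ 2 * r by omega)
  obtain ⟨f, hf⟩ := exists_injective_to_threeDimCharacters (ZMod.castHom h16 (ZMod 16))
  obtain ⟨g, hg⟩ := exists_injective_threeDimCharacters_of_algEquiv e
  obtain ⟨i, hi⟩ :=
    exists_injective_threeDimCharacters_truncatedPolynomial (n := 2 * r) (by omega)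
  have hle := Fintype.card_le_of_injective _ (hi.comp (hg.comp hf))
  -- The excluded pairs satisfy `3x + 2k ≡ 0` modulo 8, that is `x = 2k`; these are 4 of the 32,
  -- leaving 28.
  have hcard : 16 < Fintype.card
      {p : Fin 8 × Fin 4 // 6 * ((p.1 : ℕ) : ZMod 16) + 4 * ((p.2 : ℕ) : ZMod 16) ≠ 0} := by
    decide +kernel
  simp only [Fintype.card_fun, Fintype.card_bool, Fintype.card_fin] at hle
  omega
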